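/- Let $(\Omega,\mu)$ be a $\sigma$-finite measure space, let $1 \le p < \infty$, and let $L^p = L^p(\Omega,\mu)$ be the complex-valued $L^p$-space. For $f \in L^p$ let $\operatorname{supp}(f) = \{\omega \in \Omega : f(\omega) \neq 0\}$, which is determined up to a null set; inclusions between supports and inequalities between functions are understood up to null sets. Let $T : L^p \to L^p$ be a linear operator that is - positive: $Tf \ge 0$ whenever $f \ge 0$; - power bounded: $\sup_{n \ge 0} \|T^n\| < \infty$; - irreducible: for every nonzero $f \in L^p$ with $f \ge 0$ and every nonzero bounded linear functional $g$ on $L^p$ with $g \ge 0$ there is an integer $n \ge 0$ such that $\langle g, T^n f\rangle > 0$. Suppose that there is a measurable set $S \subseteq \Omega$ with $\mu(S) \neq 0$ such that $\operatorname{supp}(Tf) \supseteq \operatorname{supp}(f)$ for every $f \in L^p$ with $f \ge 0$ and $\operatorname{supp}(f) \subseteq S$. Then $$\sigma_{\mathrm{pnt}}(T) \cap \mathbb{T} \subseteq \{1\},$$ where $\sigma_{\mathrm{pnt}}(T)$ is the set of eigenvalues of $T$ and $\mathbb{T} = \{\lambda \in \mathbb{C} : |\lambda| = 1\}$. -/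

import Mathlib

open MeasureTheory
open scoped ENNReal ComplexOrder

section OrderedSpace

variable {E : Type*} [NormedAddCommGroup E] [NormedSpace ℂ E] [PartialOrder E]

/-- A linear operator on an ordered space is positive if it maps the positive cone into itself. -/
def IsPositiveOperator (T : Module.End ℂ E) : Prop :=
  ∀ f : E, 0 ≤ f → 0 ≤ T f

/-- A bounded linear functional is positive if it is nonnegative (real) on the positive cone. -/
def IsPositiveFunctional (g : StrongDual ℂ E) : Prop :=
  ∀ f : E, 0 ≤ f → 0 ≤ g f

/-- An operator is irreducible if for all nonzero `f ≥ 0` and all nonzero positive functionals `g`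
in the norm dual there is some `n ≥ 0` with `⟨g, T ^ n f⟩ > 0`. -/
def IsIrreducibleOperator (T : Module.End ℂ E) : Prop :=
  ∀ f : E, 0 ≤ f → f ≠ 0 → ∀ g : StrongDual ℂ E, IsPositiveFunctional g → g ≠ 0 →
    ∃ n : ℕ, 0 < g ((T ^ n) f)

end OrderedSpace

section NormedSpace

variable {E : Type*} [NormedAddCommGroup E] [NormedSpace ℂ E]

/-- Power boundedness: the operator norms of the powers `T ^ n`, `n ≥ 0`, have a common finite
upper bound. In particular `T` is bounded. -/
def IsPowerBounded (T : Module.End ℂ E) : Prop :=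
  ∃ C : ℝ, ∀ (n : ℕ) (f : E), ‖(T ^ n) f‖ ≤ C * ‖f‖

/-- The point spectrum: the set of all eigenvalues. -/
def pointSpectrum (T : Module.End ℂ E) : Set ℂ :=
  {l : ℂ | T.HasEigenvalue l}

end NormedSpace

section InvariantFunctional

variable {E : Type*} [NormedAddCommGroup E] [NormedSpace ℂ E]

lemma pow_apply_eq_self {T : Module.End ℂ E} {f : E} (h : T f = f) (n : ℕ) : (T ^ n) f = f := by
  induction n with
  | zero => simp
  | succ n ih => rw [pow_succ, Module.End.mul_apply, h, ih]

/-- The ergodic average of the orbit of `u` under `T`, tested against a functional. -/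
noncomputable def functionalAverage (T : Module.End ℂ E) (ψ : StrongDual ℂ E) (u : E) (n : ℕ) : ℂ :=
  ((n + 1 : ℝ)⁻¹ : ℝ) • ∑ k ∈ Finset.range (n + 1), ψ ((T ^ k) u)

lemma norm_functionalAverage_le {T : Module.End ℂ E} {C : ℝ}
    (hC : ∀ (n : ℕ) (f : E), ‖(T ^ n) f‖ ≤ C * ‖f‖) (ψ : StrongDual ℂ E) (u : E) (n : ℕ) :
    ‖functionalAverage T ψ u n‖ ≤ ‖ψ‖ * C * ‖u‖ := by
  have h1 : ‖∑ k ∈ Finset.range (n + 1), ψ ((T ^ k) u)‖ ≤ (n + 1 : ℝ) * (‖ψ‖ * C * ‖u‖) := by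
    refine (norm_sum_le_of_le (Finset.range (n + 1)) (f := fun k => ψ ((T ^ k) u))
      (n := fun _ => ‖ψ‖ * C * ‖u‖) fun k _ => ?_).trans ?_
    · calc ‖ψ ((T ^ k) u)‖ ≤ ‖ψ‖ * ‖(T ^ k) u‖ := ψ.le_opNorm _
        _ ≤ ‖ψ‖ * (C * ‖u‖) := by gcongr; exact hC k u
        _ = ‖ψ‖ * C * ‖u‖ := by ring
    · simp
  have hn : (0 : ℝ) < n + 1 := by positivity
  rw [functionalAverage, norm_smul, Real.norm_of_nonneg (by positivity)]
  calc (n + 1 : ℝ)⁻¹ * _ ≤ (n + 1 : ℝ)⁻¹ * ((n + 1 : ℝ) * (‖ψ‖ * C * ‖u‖)) := by gcongr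
    _ = ‖ψ‖ * C * ‖u‖ := by field_simp

lemma le_functionalAverage {T : Module.End ℂ E} {ψ : StrongDual ℂ E} {u : E} {c : ℂ}
    (h : ∀ k : ℕ, c ≤ ψ ((T ^ k) u)) (n : ℕ) : c ≤ functionalAverage T ψ u n := by
  have hn : (0 : ℝ) < n + 1 := by positivity
  have h1 : (n + 1 : ℝ) • c ≤ ∑ k ∈ Finset.range (n + 1), ψ ((T ^ k) u) := by
    have := Finset.card_nsmul_le_sum (Finset.range (n + 1)) (fun k => ψ ((T ^ k) u)) c
      fun k _ => h k
    simpa using this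
  have h2 := smul_le_smul_of_nonneg_left h1 (inv_nonneg.2 hn.le)
  rwa [smul_smul, inv_mul_cancel₀ hn.ne', one_smul] at h2

lemma functionalAverage_apply_sub {T : Module.End ℂ E} (ψ : StrongDual ℂ E) (u : E) (n : ℕ) :
    functionalAverage T ψ (T u) n - functionalAverage T ψ u n =
      ((n + 1 : ℝ)⁻¹ : ℝ) • (ψ ((T ^ (n + 1)) u) - ψ u) := by
  have h := Finset.sum_range_sub (fun k => ψ ((T ^ k) u)) (n + 1)
  rw [functionalAverage, functionalAverage, ← smul_sub, ← Finset.sum_sub_distrib]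
  congr 1

/-- A power bounded operator has, above each bounded functional `ψ`, an invariant bounded functional
whose value at `u` is at least any lower bound of `ψ` on the orbit of `u`. -/
theorem IsPowerBounded.exists_invariant_functional {T : Module.End ℂ E} (hT : IsPowerBounded T)
    (ψ : StrongDual ℂ E) :
    ∃ φ : StrongDual ℂ E, (∀ u, φ (T u) = φ u) ∧
      ∀ (u : E) (c : ℂ), (∀ k : ℕ, c ≤ ψ ((T ^ k) u)) → c ≤ φ u := by
  obtain ⟨C, hC⟩ := hT
  let U : Ultrafilter ℕ := Ultrafilter.of Filter.atTop
  have hU : (U : Filter ℕ) ≤ Filter.atTop := Ultrafilter.of_le _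
  have hlim : ∀ u : E, ∃ z ∈ Metric.closedBall (0 : ℂ) (‖ψ‖ * C * ‖u‖),
      Filter.Tendsto (functionalAverage T ψ u) U (nhds z) := by
    intro u
    obtain ⟨z, hz, hle⟩ := (isCompact_closedBall (0 : ℂ) (‖ψ‖ * C * ‖u‖)).ultrafilter_le_nhds
      (U.map (functionalAverage T ψ u)) (by
        rw [Ultrafilter.coe_map, Filter.le_principal_iff, Filter.mem_map]
        exact Filter.univ_mem' fun n => by
          simpa using norm_functionalAverage_le hC ψ u n)
    exact ⟨z, hz, hle⟩
  choose L hLball hL using hlim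
  let φ₀ : E →ₗ[ℂ] ℂ :=
    { toFun := L
      map_add' := fun u v => tendsto_nhds_unique (hL (u + v)) (by
        refine ((hL u).add (hL v)).congr fun n => ?_
        simp [functionalAverage, Finset.sum_add_distrib])
      map_smul' := fun c u => tendsto_nhds_unique (hL (c • u)) (by
        refine ((hL u).const_mul c).congr fun n => ?_
        simp only [functionalAverage, map_smul, smul_eq_mul, ← Finset.mul_sum]
        rw [mul_smul_comm]) }
  refine ⟨φ₀.mkContinuous (‖ψ‖ * C) fun u => by
    simpa [φ₀] using mem_closedBall_zero_iff.1 (hLball u), fun u => ?_, fun u c hc => ?_⟩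
  · have h0 : Filter.Tendsto (fun n => functionalAverage T ψ (T u) n - functionalAverage T ψ u n)
        U (nhds 0) := by
      refine Filter.Tendsto.mono_left ?_ hU
      have hb : Filter.Tendsto (fun n : ℕ => (n + 1 : ℝ)⁻¹ * (‖ψ‖ * (C * ‖u‖) + ‖ψ u‖))
          Filter.atTop (nhds 0) := by
        simpa [one_div] using
          (tendsto_one_div_add_atTop_nhds_zero_nat (𝕜 := ℝ)).mul_const (‖ψ‖ * (C * ‖u‖) + ‖ψ u‖)
      refine squeeze_zero_norm (fun n => ?_) hb
      rw [functionalAverage_apply_sub, norm_smul, Real.norm_of_nonneg (by positivity)]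
      gcongr
      refine (norm_sub_le _ _).trans ?_
      gcongr
      exact (ψ.le_opNorm _).trans (by gcongr; exact hC _ u)
    exact sub_eq_zero.1 (tendsto_nhds_unique ((hL (T u)).sub (hL u)) h0)
  · exact ge_of_tendsto' (hL u) (le_functionalAverage hc)

end InvariantFunctional

section OrderedEigenvector

variable {E : Type*} [NormedAddCommGroup E] [NormedSpace ℂ E] [PartialOrder E]

lemma IsPositiveOperator.pow_apply_nonneg {T : Module.End ℂ E} (hT : IsPositiveOperator T) {f : E}
    (hf : 0 ≤ f) (n : ℕ) : 0 ≤ (T ^ n) f := by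
  induction n with
  | zero => simpa
  | succ n ih => rw [pow_succ']; exact hT _ ih

/-- A power bounded irreducible positive operator has no proper subinvariant positive vector:
if `0 ≤ h ≤ T h` and some positive functional is strictly positive at `h`, then `T h = h`. -/
theorem apply_eq_self_of_le [IsOrderedAddMonoid E] {T : Module.End ℂ E}
    (hpos : IsPositiveOperator T) (hbdd : IsPowerBounded T) (hirr : IsIrreducibleOperator T)
    {h : E} (hle : h ≤ T h) {ψ : StrongDual ℂ E}
    (hψ : IsPositiveFunctional ψ) (hψh : 0 < ψ h) : T h = h := by
  obtain ⟨φ, hφT, hφ⟩ := hbdd.exists_invariant_functional ψ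
  have hmono : ∀ k : ℕ, h ≤ (T ^ k) h := by
    intro k
    induction k with
    | zero => simp
    | succ k ih =>
      refine ih.trans ?_
      rw [pow_succ, Module.End.mul_apply, ← sub_nonneg, ← map_sub]
      exact hpos.pow_apply_nonneg (sub_nonneg.2 hle) k
  have hφh : 0 < φ h := hψh.trans_le <| hφ h _ fun k => by
    rw [← sub_nonneg, ← map_sub]
    exact hψ _ (sub_nonneg.2 (hmono k))
  have hφpos : IsPositiveFunctional φ := fun f hf =>
    hφ f 0 fun k => hψ _ (hpos.pow_apply_nonneg hf k)
  have hφ0 : φ ≠ 0 := by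
    rintro rfl
    simp at hφh
  by_contra hne
  obtain ⟨n, hn⟩ := hirr (T h - h) (sub_nonneg.2 hle) (sub_ne_zero.2 hne) φ hφpos hφ0
  have hinv : ∀ (k : ℕ) (u : E), φ ((T ^ k) u) = φ u := by
    intro k u
    induction k with
    | zero => simp
    | succ k ih => rw [pow_succ', Module.End.mul_apply, hφT, ih]
  rw [hinv, map_sub, hφT, sub_self] at hn
  exact lt_irrefl _ hn

end OrderedEigenvector

namespace MeasureTheory.Lp

variable {Ω : Type*} [MeasurableSpace Ω] {μ : Measure Ω} {p : ℝ≥0∞}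

/-- The modulus of a complex `L^p` function, as a complex `L^p` function. -/
noncomputable def modulus (f : Lp ℂ p μ) : Lp ℂ p μ :=
  MemLp.toLp (fun x => ((‖f x‖ : ℝ) : ℂ)) ((Lp.memLp f).norm.ofReal (K := ℂ))

lemma coeFn_modulus (f : Lp ℂ p μ) : ∀ᵐ x ∂μ, modulus f x = ((‖f x‖ : ℝ) : ℂ) :=
  MemLp.coeFn_toLp _

/-- The real part of a complex `L^p` function, as a complex `L^p` function. -/
noncomputable def realPart (f : Lp ℂ p μ) : Lp ℂ p μ :=
  MemLp.toLp (fun x => (((f x).re : ℝ) : ℂ)) ((Lp.memLp f).re.ofReal (K := ℂ))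

lemma coeFn_realPart (f : Lp ℂ p μ) : ∀ᵐ x ∂μ, realPart f x = (((f x).re : ℝ) : ℂ) :=
  MemLp.coeFn_toLp _

lemma nonneg_iff_ae {f : Lp ℂ p μ} : 0 ≤ f ↔ ∀ᵐ x ∂μ, 0 ≤ f x :=
  (Lp.coeFn_nonneg f).symm

lemma le_iff_ae {f g : Lp ℂ p μ} : f ≤ g ↔ ∀ᵐ x ∂μ, f x ≤ g x :=
  (Lp.coeFn_le f g).symm

lemma modulus_nonneg (f : Lp ℂ p μ) : 0 ≤ modulus f :=
  nonneg_iff_ae.2 <| (coeFn_modulus f).mono fun x hx => by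
    rw [hx]; exact Complex.zero_le_real.2 (norm_nonneg _)

lemma modulus_add_realPart_nonneg (f : Lp ℂ p μ) : 0 ≤ modulus f + realPart f := by
  rw [nonneg_iff_ae]
  filter_upwards [coeFn_modulus f, coeFn_realPart f, Lp.coeFn_add (modulus f) (realPart f)]
    with x h1 h2 h3
  rw [h3, Pi.add_apply, h1, h2, ← Complex.ofReal_add, Complex.zero_le_real]
  linarith [neg_abs_le (f x).re, Complex.abs_re_le_norm (f x)]

lemma realPart_add_I_smul_realPart (f : Lp ℂ p μ) :
    realPart f + Complex.I • realPart (-Complex.I • f) = f := by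
  apply Lp.ext
  filter_upwards [coeFn_realPart f, coeFn_realPart (-Complex.I • f),
    Lp.coeFn_add (realPart f) (Complex.I • realPart (-Complex.I • f)),
    Lp.coeFn_smul (-Complex.I) f, Lp.coeFn_smul Complex.I (realPart (-Complex.I • f))]
    with x h1 h2 h3 h4 h5
  rw [h3, Pi.add_apply, h5, Pi.smul_apply, h1, h2, h4]
  apply Complex.ext <;> simp

section Operator

variable [Fact (1 ≤ p)]

lemma ae_im_apply_realPart {T : Module.End ℂ (Lp ℂ p μ)} (hT : IsPositiveOperator T)
    (f : Lp ℂ p μ) : ∀ᵐ x ∂μ, (T (realPart f) x).im = 0 := by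
  have h1 := nonneg_iff_ae.1 (hT _ (modulus_add_realPart_nonneg f))
  have h2 := nonneg_iff_ae.1 (hT _ (modulus_nonneg f))
  have h3 : T (realPart f) = T (modulus f + realPart f) - T (modulus f) := by
    rw [← map_sub, add_sub_cancel_left]
  rw [h3]
  filter_upwards [h1, h2, Lp.coeFn_sub (T (modulus f + realPart f)) (T (modulus f))]
    with x h1 h2 h4
  rw [h4, Pi.sub_apply, Complex.sub_im, ← (Complex.nonneg_iff.1 h1).2,
    ← (Complex.nonneg_iff.1 h2).2, sub_zero]

/-- A positive operator commutes with taking real parts. -/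
lemma ae_apply_realPart {T : Module.End ℂ (Lp ℂ p μ)} (hT : IsPositiveOperator T)
    (f : Lp ℂ p μ) : ∀ᵐ x ∂μ, T (realPart f) x = (((T f x).re : ℝ) : ℂ) := by
  have h : T f = T (realPart f) + Complex.I • T (realPart (-Complex.I • f)) := by
    rw [← map_smul, ← map_add, realPart_add_I_smul_realPart]
  filter_upwards [ae_im_apply_realPart hT f, ae_im_apply_realPart hT (-Complex.I • f),
    Lp.coeFn_add (T (realPart f)) (Complex.I • T (realPart (-Complex.I • f))),
    Lp.coeFn_smul Complex.I (T (realPart (-Complex.I • f)))] with x h1 h2 h3 h4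
  rw [h, h3, Pi.add_apply, h4, Pi.smul_apply]
  apply Complex.ext <;> simp only [smul_eq_mul, Complex.add_re, Complex.I_mul_re,
    Complex.ofReal_re, Complex.ofReal_im, h1, h2, neg_zero, add_zero]

/-- The triangle inequality `|T f| ≤ T |f|` for positive operators. -/
theorem modulus_apply_le {T : Module.End ℂ (Lp ℂ p μ)} (hT : IsPositiveOperator T)
    (f : Lp ℂ p μ) : modulus (T f) ≤ T (modulus f) := by
  have hc : ∀ c : ℂ, ∀ᵐ x ∂μ, (c * T f x).re ≤ ‖c‖ * (T (modulus f) x).re := by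
    intro c
    have hle : 0 ≤ (‖c‖ : ℂ) • modulus f - realPart (c • f) := by
      rw [nonneg_iff_ae]
      filter_upwards [coeFn_modulus f, coeFn_realPart (c • f), Lp.coeFn_smul c f,
        Lp.coeFn_smul (‖c‖ : ℂ) (modulus f),
        Lp.coeFn_sub ((‖c‖ : ℂ) • modulus f) (realPart (c • f))] with x h1 h2 h3 h4 h5
      rw [h5, Pi.sub_apply, h4, Pi.smul_apply, h1, h2, h3, Pi.smul_apply, smul_eq_mul, smul_eq_mul,
        ← Complex.ofReal_mul, ← Complex.ofReal_sub, Complex.zero_le_real, ← norm_mul, sub_nonneg]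
      exact Complex.re_le_norm _
    have hT' := hT _ hle
    rw [map_sub, map_smul, nonneg_iff_ae] at hT'
    filter_upwards [hT', ae_apply_realPart hT (c • f), Lp.coeFn_smul (‖c‖ : ℂ) (T (modulus f)),
      Lp.coeFn_sub ((‖c‖ : ℂ) • T (modulus f)) (T (realPart (c • f))),
      Lp.coeFn_smul c (T f)] with x h1 h2 h3 h4 h5
    rw [h4, Pi.sub_apply, h2, h3, Pi.smul_apply, map_smul, h5, Pi.smul_apply] at h1
    simpa using (Complex.nonneg_iff.1 h1).1
  have hall := ae_all_iff.2 fun n : ℕ => hc (TopologicalSpace.denseSeq ℂ n)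
  rw [le_iff_ae]
  filter_upwards [hall, coeFn_modulus (T f), nonneg_iff_ae.1 (hT _ (modulus_nonneg f))]
    with x hx h1 h2
  have hext : ∀ c : ℂ, (c * T f x).re ≤ ‖c‖ * (T (modulus f) x).re := fun c =>
    (TopologicalSpace.denseRange_denseSeq ℂ).induction_on
      (p := fun c : ℂ => (c * T f x).re ≤ ‖c‖ * (T (modulus f) x).re) c
      (isClosed_le (by fun_prop) (by fun_prop)) hx
  have h3 := hext (starRingEnd ℂ (T f x))
  rw [← Complex.normSq_eq_conj_mul_self, Complex.ofReal_re, Complex.normSq_eq_norm_sq,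
    RCLike.norm_conj, sq] at h3
  rw [h1, Complex.le_def]
  refine ⟨?_, by simpa using (Complex.nonneg_iff.1 h2).2⟩
  rcases (norm_nonneg (T f x)).eq_or_lt with h0 | h0
  · simpa [← h0] using (Complex.nonneg_iff.1 h2).1
  · simpa using le_of_mul_le_mul_left h3 h0

end Operator

section SetIntegral

lemma setIntegral_modulus_eq (f : Lp ℂ p μ) (B : Set Ω) :
    ∫ x in B, modulus f x ∂μ = ((∫ x in B, ‖f x‖ ∂μ : ℝ) : ℂ) := by
  refine Eq.trans ?_ (integral_ofReal (𝕜 := ℂ))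
  exact integral_congr_ae (ae_restrict_of_ae (coeFn_modulus f))

variable [Fact (1 ≤ p)]

lemma integrableOn_of_measure_ne_top (f : Lp ℂ p μ) {B : Set Ω} (hB : μ B ≠ ∞) :
    IntegrableOn f B μ := by
  have : IsFiniteMeasure (μ.restrict B) := ⟨by simpa using hB.lt_top⟩
  exact ((Lp.memLp f).restrict B).integrable Fact.out

/-- Integration over a set of finite measure, as a bounded functional on `L^p`. -/
theorem exists_setIntegral_functional {B : Set Ω} (hB : μ B ≠ ∞) :
    ∃ ψ : StrongDual ℂ (Lp ℂ p μ), ∀ f, ψ f = ∫ x in B, f x ∂μ := by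
  let ψ₀ : Lp ℂ p μ →ₗ[ℂ] ℂ :=
    { toFun := fun f => ∫ x in B, f x ∂μ
      map_add' := fun f g => by
        rw [← integral_add (integrableOn_of_measure_ne_top f hB)
          (integrableOn_of_measure_ne_top g hB)]
        exact integral_congr_ae (ae_restrict_of_ae (Lp.coeFn_add f g))
      map_smul' := fun c f => by
        rw [RingHom.id_apply, ← integral_smul]
        exact integral_congr_ae (ae_restrict_of_ae (Lp.coeFn_smul c f)) }
  refine ⟨ψ₀.mkContinuous ((μ B ^ (1 / (1 : ℝ≥0∞).toReal - 1 / p.toReal)).toReal)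
    fun f => ?_, fun f => rfl⟩
  have hexp : 0 ≤ 1 / (1 : ℝ≥0∞).toReal - 1 / p.toReal := by
    rcases eq_or_ne p ∞ with rfl | hp
    · simp
    · have : 1 ≤ p.toReal := by
        simpa using ENNReal.toReal_mono hp (Fact.out : 1 ≤ p)
      simpa using inv_le_one_of_one_le₀ this
  have hfin : μ B ^ (1 / (1 : ℝ≥0∞).toReal - 1 / p.toReal) ≠ ∞ :=
    ENNReal.rpow_ne_top_of_nonneg hexp hB
  have key : ‖∫ x in B, f x ∂μ‖ₑ ≤
      μ B ^ (1 / (1 : ℝ≥0∞).toReal - 1 / p.toReal) * eLpNorm f p μ := by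
    refine (enorm_integral_le_lintegral_enorm _).trans ?_
    rw [← eLpNorm_one_eq_lintegral_enorm, mul_comm]
    refine (eLpNorm_le_eLpNorm_mul_rpow_measure_univ (Fact.out : 1 ≤ p)
      (Lp.aestronglyMeasurable f).restrict).trans ?_
    rw [Measure.restrict_apply_univ]
    gcongr
    exact Measure.restrict_le_self
  have := ENNReal.toReal_mono (ENNReal.mul_ne_top hfin (Lp.eLpNorm_ne_top f)) key
  rwa [ENNReal.toReal_mul, toReal_enorm, ← Lp.norm_def] at this

lemma isPositiveFunctional_of_setIntegral {B : Set Ω} {ψ : StrongDual ℂ (Lp ℂ p μ)}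
    (hψ : ∀ f, ψ f = ∫ x in B, f x ∂μ) : IsPositiveFunctional ψ := by
  intro f hf
  rw [hψ]
  have h : ∫ x in B, f x ∂μ = ((∫ x in B, (f x).re ∂μ : ℝ) : ℂ) := by
    refine Eq.trans ?_ (integral_ofReal (𝕜 := ℂ))
    refine integral_congr_ae (ae_restrict_of_ae ?_)
    filter_upwards [nonneg_iff_ae.1 hf] with x hx
    exact Complex.eq_re_of_ofReal_le (r := 0) (by simpa using hx)
  rw [h, Complex.zero_le_real]
  exact integral_nonneg_of_ae (ae_restrict_of_ae
    ((nonneg_iff_ae.1 hf).mono fun x hx => (Complex.nonneg_iff.1 hx).1))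

/-- A nonzero `L^p` function has strictly positive pairing of its modulus with some positive
functional. -/
theorem exists_functional_modulus_pos [SigmaFinite μ] {f : Lp ℂ p μ} (hf : f ≠ 0) :
    ∃ ψ : StrongDual ℂ (Lp ℂ p μ), IsPositiveFunctional ψ ∧ 0 < ψ (modulus f) := by
  have hmeas : MeasurableSet (Function.support f) :=
    (Lp.stronglyMeasurable f).measurable (measurableSet_singleton 0).compl
  have hsupp : μ (Function.support f) ≠ 0 := fun h => hf <| by
    rw [Lp.eq_zero_iff_ae_eq_zero]
    exact h
  obtain ⟨B, hBm, hBs, hB0, hBt⟩ :=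
    Measure.exists_subset_measure_lt_top hmeas (pos_iff_ne_zero.2 hsupp)
  obtain ⟨ψ, hψ⟩ := exists_setIntegral_functional (p := p) hBt.ne
  refine ⟨ψ, isPositiveFunctional_of_setIntegral hψ, ?_⟩
  rw [hψ, setIntegral_modulus_eq, Complex.zero_lt_real,
    setIntegral_pos_iff_support_of_nonneg_ae (Filter.Eventually.of_forall fun x => norm_nonneg _)
      (integrableOn_of_measure_ne_top f hBt.ne).norm]
  rwa [Set.inter_eq_self_of_subset_right]
  intro x hx
  simpa using hBs hx

/-- A nonzero fixed modulus of an irreducible operator cannot vanish a.e. on a set of positive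
measure. -/
theorem measure_inter_support_ne_zero [SigmaFinite μ] {T : Module.End ℂ (Lp ℂ p μ)}
    (hirr : IsIrreducibleOperator T) {f : Lp ℂ p μ} (hf : modulus f ≠ 0)
    (hfix : T (modulus f) = modulus f) {S : Set Ω} (hSm : MeasurableSet S) (hS : μ S ≠ 0) :
    μ (S ∩ Function.support f) ≠ 0 := by
  intro h0
  obtain ⟨B, hBm, hBs, hB0, hBt⟩ :=
    Measure.exists_subset_measure_lt_top hSm (pos_iff_ne_zero.2 hS)
  obtain ⟨ψ, hψ⟩ := exists_setIntegral_functional (p := p) hBt.ne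
  have hψ0 : ψ ≠ 0 := by
    intro h
    have h1 := hψ (indicatorConstLp p hBm hBt.ne 1)
    rw [setIntegral_congr_ae (g := fun _ => (1 : ℂ)) hBm
      (indicatorConstLp_coeFn.mono fun x hx hxB => by rw [hx, Set.indicator_of_mem hxB])] at h1
    have h2 : (μ B).toReal ≠ 0 := (ENNReal.toReal_pos hB0.ne' hBt.ne).ne'
    refine h2 (Complex.ofReal_eq_zero.1 ?_)
    simpa [h, Measure.real] using h1.symm
  obtain ⟨n, hn⟩ := hirr _ (modulus_nonneg f) hf ψ (isPositiveFunctional_of_setIntegral hψ) hψ0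
  rw [pow_apply_eq_self hfix, hψ, setIntegral_modulus_eq, setIntegral_congr_ae (g := fun _ => 0) hBm,
    integral_zero] at hn
  · simp at hn
  · have : ∀ᵐ x ∂μ, x ∉ S ∩ Function.support f := measure_eq_zero_iff_ae_notMem.1 h0
    filter_upwards [this] with x hx hxB
    simpa using fun h => hx ⟨hBs hxB, h⟩

end SetIntegral

section Rotation

/-- The function `|f| · |f / |f| - a|²`, written so as to be defined where `f` vanishes. -/
noncomputable def phaseDeviation (f : Lp ℂ p μ) (a : ℂ) : Lp ℂ p μ :=
  ((1 + ‖a‖ ^ 2 : ℝ) : ℂ) • modulus f - (2 : ℂ) • realPart (starRingEnd ℂ a • f)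

lemma norm_mul_sub_sq {z s a : ℂ} {r : ℝ} (hs : ‖s‖ = 1) (hz : z = r * s) :
    (1 + ‖a‖ ^ 2) * r - 2 * (starRingEnd ℂ a * z).re = r * ‖s - a‖ ^ 2 := by
  subst hz
  have h1 : s.re * s.re + s.im * s.im = 1 := by
    rw [← Complex.normSq_apply, Complex.normSq_eq_norm_sq, hs, one_pow]
  rw [← Complex.normSq_eq_norm_sq, ← Complex.normSq_eq_norm_sq, Complex.normSq_apply,
    Complex.normSq_apply]
  simp
  linear_combination (-r) * h1

lemma coeFn_phaseDeviation (f : Lp ℂ p μ) (a : ℂ) :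
    ∀ᵐ x ∂μ, phaseDeviation f a x =
      (((1 + ‖a‖ ^ 2) * ‖f x‖ - 2 * (starRingEnd ℂ a * f x).re : ℝ) : ℂ) := by
  filter_upwards [coeFn_modulus f, coeFn_realPart (starRingEnd ℂ a • f),
    Lp.coeFn_smul (starRingEnd ℂ a) f, Lp.coeFn_smul ((1 + ‖a‖ ^ 2 : ℝ) : ℂ) (modulus f),
    Lp.coeFn_smul (2 : ℂ) (realPart (starRingEnd ℂ a • f)),
    Lp.coeFn_sub (((1 + ‖a‖ ^ 2 : ℝ) : ℂ) • modulus f)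
      ((2 : ℂ) • realPart (starRingEnd ℂ a • f))] with x h1 h2 h3 h4 h5 h6
  rw [phaseDeviation, h6, Pi.sub_apply, h4, h5, Pi.smul_apply, Pi.smul_apply, h1, h2, h3,
    Pi.smul_apply]
  push_cast
  simp only [smul_eq_mul]

variable [Fact (1 ≤ p)]

lemma ae_apply_phaseDeviation {T : Module.End ℂ (Lp ℂ p μ)} (hT : IsPositiveOperator T)
    {f : Lp ℂ p μ} (hfix : T (modulus f) = modulus f) {l : ℂ} (hl : T f = l • f) (a : ℂ) :
    ∀ᵐ x ∂μ, T (phaseDeviation f a) x =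
      (((1 + ‖a‖ ^ 2) * ‖f x‖ - 2 * (starRingEnd ℂ a * (l * f x)).re : ℝ) : ℂ) := by
  have h0 : T (phaseDeviation f a) = ((1 + ‖a‖ ^ 2 : ℝ) : ℂ) • modulus f -
      (2 : ℂ) • T (realPart (starRingEnd ℂ a • f)) := by
    rw [phaseDeviation, map_sub, map_smul, map_smul, hfix]
  have h7 : T (starRingEnd ℂ a • f) = starRingEnd ℂ a • l • f := by rw [map_smul, hl]
  filter_upwards [coeFn_modulus f, ae_apply_realPart hT (starRingEnd ℂ a • f),
    Lp.coeFn_smul (starRingEnd ℂ a) (l • f), Lp.coeFn_smul l f,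
    Lp.coeFn_smul ((1 + ‖a‖ ^ 2 : ℝ) : ℂ) (modulus f),
    Lp.coeFn_smul (2 : ℂ) (T (realPart (starRingEnd ℂ a • f))),
    Lp.coeFn_sub (((1 + ‖a‖ ^ 2 : ℝ) : ℂ) • modulus f)
      ((2 : ℂ) • T (realPart (starRingEnd ℂ a • f)))] with x h1 h2 h3 h8 h4 h5 h6
  rw [h0, h6, Pi.sub_apply, h4, h5, Pi.smul_apply, Pi.smul_apply, h1, h2, h7, h3,
    Pi.smul_apply, h8, Pi.smul_apply]
  push_cast
  simp only [smul_eq_mul]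

/-- Let `f` be an eigenvector of a positive operator for the unimodular eigenvalue `l ≠ 1`, with
fixed modulus. If `u` is dominated by `|f|` and vanishes off the set where the phase of `f` is close
to `d`, then `T u` vanishes almost everywhere on that set. -/
theorem ae_apply_eq_zero_of_phase_near {T : Module.End ℂ (Lp ℂ p μ)} (hT : IsPositiveOperator T)
    {f : Lp ℂ p μ} (hfix : T (modulus f) = modulus f) {l : ℂ} (hl : T f = l • f) (hl1 : ‖l‖ = 1)
    {ε : ℝ} (hε : 0 < ε) (hle : 8 * ε ≤ ‖1 - l‖) (d : ℂ) {u : Lp ℂ p μ} (hu : 0 ≤ u)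
    (huf : ∀ᵐ x ∂μ, u x = 0 ∨
      (u x = ((‖f x‖ : ℝ) : ℂ) ∧ f x ≠ 0 ∧ ‖f x / (‖f x‖ : ℝ) - d‖ < ε)) :
    ∀ᵐ x ∂μ, f x ≠ 0 → ‖f x / (‖f x‖ : ℝ) - d‖ < ε → T u x = 0 := by
  have hphase : ∀ z : ℂ, z ≠ 0 → ‖z / (‖z‖ : ℝ)‖ = 1 ∧ z = (‖z‖ : ℝ) * (z / (‖z‖ : ℝ)) := by
    intro z hz
    have hz' : ((‖z‖ : ℝ) : ℂ) ≠ 0 := by simpa using hz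
    exact ⟨by simp [hz], by field_simp⟩
  have hbound : ∀ a : ℂ, ‖a - l * d‖ < 2 * ε → ∀ᵐ x ∂μ, ε ^ 2 * (T u x).re ≤
      (1 + ‖a‖ ^ 2) * ‖f x‖ - 2 * (starRingEnd ℂ a * (l * f x)).re := by
    intro a ha
    have hdom : 0 ≤ phaseDeviation f a - ((ε ^ 2 : ℝ) : ℂ) • u := by
      rw [nonneg_iff_ae]
      filter_upwards [coeFn_phaseDeviation f a, Lp.coeFn_smul ((ε ^ 2 : ℝ) : ℂ) u, huf,
        Lp.coeFn_sub (phaseDeviation f a) (((ε ^ 2 : ℝ) : ℂ) • u)] with x h1 h2 h3 h4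
      rw [h4, Pi.sub_apply, h2, h1, Pi.smul_apply]
      have hnn : 0 ≤ (1 + ‖a‖ ^ 2) * ‖f x‖ - 2 * (starRingEnd ℂ a * f x).re := by
        by_cases hx : f x = 0
        · simp [hx]
        · rw [norm_mul_sub_sq (hphase _ hx).1 (hphase _ hx).2]
          positivity
      rcases h3 with h3 | ⟨h3, hx, hd⟩
      · rw [h3, smul_zero, sub_zero, Complex.zero_le_real]
        exact hnn
      · rw [h3, smul_eq_mul, ← Complex.ofReal_mul, ← Complex.ofReal_sub, Complex.zero_le_real,
          norm_mul_sub_sq (hphase _ hx).1 (hphase _ hx).2, sub_nonneg, mul_comm]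
        set s := f x / (‖f x‖ : ℝ) with hs
        have hs1 : ‖s‖ = 1 := (hphase _ hx).1
        have e1 : ‖(1 - l) * s‖ = ‖1 - l‖ := by rw [norm_mul, hs1, mul_one]
        have e2 : (1 - l) * s = (s - a) + (a - l * d) - l * (s - d) := by ring
        have e3 : ‖l * (s - d)‖ < ε := by rw [norm_mul, hl1, one_mul]; exact hd
        have e4 := norm_sub_le ((s - a) + (a - l * d)) (l * (s - d))
        have e5 := norm_add_le (s - a) (a - l * d)
        rw [← e2, e1] at e4
        have e6 : ε ≤ ‖s - a‖ := by linarith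
        gcongr
    have hT' := hT _ hdom
    rw [map_sub, map_smul, nonneg_iff_ae] at hT'
    filter_upwards [hT', ae_apply_phaseDeviation hT hfix hl a,
      Lp.coeFn_smul ((ε ^ 2 : ℝ) : ℂ) (T u),
      Lp.coeFn_sub (T (phaseDeviation f a)) (((ε ^ 2 : ℝ) : ℂ) • T u)] with x h1 h2 h3 h4
    rw [h4, Pi.sub_apply, h3, h2, Pi.smul_apply, smul_eq_mul] at h1
    have h5 := (Complex.nonneg_iff.1 h1).1
    rw [Complex.sub_re, Complex.re_ofReal_mul, Complex.ofReal_re] at h5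
    linarith
  have hall : ∀ᵐ x ∂μ, ∀ n : ℕ, ‖TopologicalSpace.denseSeq ℂ n - l * d‖ < 2 * ε →
      ε ^ 2 * (T u x).re ≤ (1 + ‖TopologicalSpace.denseSeq ℂ n‖ ^ 2) * ‖f x‖ -
        2 * (starRingEnd ℂ (TopologicalSpace.denseSeq ℂ n) * (l * f x)).re :=
    ae_all_iff.2 fun n => by
      by_cases h : ‖TopologicalSpace.denseSeq ℂ n - l * d‖ < 2 * ε
      · exact (hbound _ h).mono fun x hx _ => hx
      · exact Filter.Eventually.of_forall fun x hx => absurd hx h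
  filter_upwards [hall, nonneg_iff_ae.1 (hT u hu)] with x hx hnn h0 hd
  obtain ⟨hs1, hs⟩ := hphase _ h0
  set s := f x / (‖f x‖ : ℝ) with hsdef
  have hls : ‖l * s‖ = 1 := by rw [norm_mul, hl1, hs1, one_mul]
  have hfl : l * f x = (‖f x‖ : ℝ) * (l * s) := by
    conv_lhs => rw [hs]
    ring
  have hnear : ‖l * s - l * d‖ < ε := by rw [← mul_sub, norm_mul, hl1, one_mul]; exact hd
  have hη : ∀ η : ℝ, 0 < η → η ≤ ε → ε ^ 2 * (T u x).re ≤ ‖f x‖ * η ^ 2 := by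
    intro η hη hηε
    obtain ⟨n, hn⟩ := (TopologicalSpace.denseRange_denseSeq ℂ).exists_dist_lt (l * s) hη
    rw [Complex.dist_eq] at hn
    set a := TopologicalSpace.denseSeq ℂ n
    have ha : ‖a - l * d‖ < 2 * ε := by
      have : a - l * d = (l * s - l * d) - (l * s - a) := by ring
      rw [this]
      linarith [norm_sub_le (l * s - l * d) (l * s - a)]
    refine (hx n ha).trans ?_
    rw [norm_mul_sub_sq hls hfl]
    gcongr
  have hre : ε ^ 2 * (T u x).re ≤ 0 := by
    have hlim : Filter.Tendsto (fun η : ℝ => ‖f x‖ * η ^ 2) (nhdsWithin 0 (Set.Ioi 0))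
        (nhds 0) := by
      have : Continuous fun η : ℝ => ‖f x‖ * η ^ 2 := by fun_prop
      simpa using (this.tendsto 0).mono_left nhdsWithin_le_nhds
    refine ge_of_tendsto hlim ?_
    filter_upwards [Ioc_mem_nhdsGT hε] with η h
    exact hη η h.1 h.2
  obtain ⟨h1, h2⟩ := Complex.nonneg_iff.1 hnn
  have h3 : (T u x).re = 0 := le_antisymm (by nlinarith [pow_pos hε 2]) h1
  exact Complex.ext h3 h2.symm

end Rotation

end MeasureTheory.Lp

open MeasureTheory.Lp in
theorem theorem1p2 {Ω : Type*} [MeasurableSpace Ω] (μ : Measure Ω) [SigmaFinite μ]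
    (p : ℝ≥0∞) [Fact (1 ≤ p)] (hp : p ≠ ∞)
    (T : Module.End ℂ (Lp ℂ p μ))
    (hpos : IsPositiveOperator T)
    (hbdd : IsPowerBounded T)
    (hirr : IsIrreducibleOperator T)
    (hS : ∃ S : Set Ω, MeasurableSet S ∧ μ S ≠ 0 ∧
      ∀ f : Lp ℂ p μ, 0 ≤ f → Function.support f ≤ᵐ[μ] S →
        Function.support f ≤ᵐ[μ] Function.support (T f)) :
    pointSpectrum T ∩ Metric.sphere (0 : ℂ) 1 ⊆ {1} := by
  rintro l ⟨hl, hl1⟩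
  rw [mem_sphere_zero_iff_norm] at hl1
  obtain ⟨f, hf, hf0⟩ := Module.End.HasEigenvalue.exists_hasEigenvector hl
  rw [Module.End.mem_eigenspace_iff] at hf
  obtain ⟨S, hSm, hS0, hsupp⟩ := hS
  by_contra hne
  have hmod : modulus (T f) = modulus f := by
    apply Lp.ext
    filter_upwards [coeFn_modulus (T f), coeFn_modulus f, Lp.coeFn_smul l f] with x h1 h2 h3
    rw [h1, h2, hf, h3, Pi.smul_apply, norm_smul, hl1, one_mul]
  obtain ⟨ψ, hψ, hψf⟩ := exists_functional_modulus_pos hf0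
  have hfix : T (modulus f) = modulus f :=
    apply_eq_self_of_le hpos hbdd hirr (by simpa [hmod] using modulus_apply_le hpos f) hψ hψf
  have hmod0 : modulus f ≠ 0 := by
    intro h
    simp [h] at hψf
  have hSf := measure_inter_support_ne_zero hirr hmod0 hfix hSm hS0
  have hgap : 0 < ‖1 - l‖ := norm_pos_iff.2 (sub_ne_zero.2 (Ne.symm hne))
  obtain ⟨ε, hε, hεl⟩ : ∃ ε : ℝ, 0 < ε ∧ 8 * ε ≤ ‖1 - l‖ :=
    ⟨‖1 - l‖ / 8, by positivity, by linarith⟩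
  let A : ℕ → Set Ω := fun n => S ∩ {x | f x ≠ 0 ∧
    ‖f x / (‖f x‖ : ℝ) - TopologicalSpace.denseSeq ℂ n‖ < ε}
  have hfm : Measurable f := (Lp.stronglyMeasurable f).measurable
  have hA : ∀ n, MeasurableSet (A n) := fun n =>
    hSm.inter ((hfm (measurableSet_singleton 0).compl).inter
      (measurableSet_lt ((hfm.div (Complex.measurable_ofReal.comp hfm.norm)).sub_const _).norm
        measurable_const))
  obtain ⟨n, hn⟩ : ∃ n, μ (A n) ≠ 0 := by
    by_contra! h
    refine hSf (measure_mono_null (fun x hx => ?_) (measure_iUnion_null h))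
    obtain ⟨n, hn⟩ := (TopologicalSpace.denseRange_denseSeq ℂ).exists_dist_lt
      (f x / (‖f x‖ : ℝ)) hε
    rw [Complex.dist_eq] at hn
    exact Set.mem_iUnion.2 ⟨n, hx.1, hx.2, hn⟩
  have huL : MemLp ((A n).indicator (modulus f)) p μ := (Lp.memLp (modulus f)).indicator (hA n)
  have hu : ∀ᵐ x ∂μ, huL.toLp _ x = (A n).indicator (fun x => ((‖f x‖ : ℝ) : ℂ)) x := by
    filter_upwards [huL.coeFn_toLp, coeFn_modulus f] with x h1 h2
    rw [h1]
    by_cases hx : x ∈ A n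
    · rw [Set.indicator_of_mem hx, Set.indicator_of_mem hx, h2]
    · rw [Set.indicator_of_notMem hx, Set.indicator_of_notMem hx]
  have hu0 : 0 ≤ huL.toLp _ := by
    rw [nonneg_iff_ae]
    filter_upwards [hu] with x hx
    rw [hx]
    exact Set.indicator_nonneg (fun x _ => Complex.zero_le_real.2 (norm_nonneg _)) x
  have huS : Function.support (huL.toLp _) ≤ᵐ[μ] S := by
    filter_upwards [hu] with x hx hxu
    by_contra hxS
    exact hxu (by rw [hx, Set.indicator_of_notMem fun h => hxS h.1])
  have hzero := ae_apply_eq_zero_of_phase_near hpos hfix hf hl1 hε hεl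
    (TopologicalSpace.denseSeq ℂ n) hu0 (by
      filter_upwards [hu] with x hx
      by_cases hxA : x ∈ A n
      · exact Or.inr ⟨by rw [hx, Set.indicator_of_mem hxA], hxA.2⟩
      · exact Or.inl (by rw [hx, Set.indicator_of_notMem hxA]))
  refine hn (measure_eq_zero_iff_ae_notMem.2 ?_)
  filter_upwards [hu, hzero, hsupp _ hu0 huS] with x h1 h2 h3 hxA
  refine h3 ?_ (h2 hxA.2.1 hxA.2.2)
  change huL.toLp _ x ≠ 0
  rw [h1, Set.indicator_of_mem hxA]
  simpa using hxA.2.1
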